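/- Let $k$ be a field with $\operatorname{char}(k)\neq 2$. Let $K_0(Var_k)$ be the Grothendieck ring of $k$-varieties (separated schemes of finite type over $k$): the abelian group generated by the isomorphism classes $[X]$ of $k$-varieties modulo the relations $[X]=[X\setminus Z]+[Z]$ for closed subvarieties $Z\subset X$, with product induced by $[X][Y]=[X\times_k Y]$. Let $\mathbb L=[\mathbb A^1_k]$, and let $\hat K_0(Var_k)$ be the completion of $K_0(Var_k)[\mathbb L^{-1}]$ with respect to the filtration by the additive subgroups $F^m$ generated by the elements $\mathbb L^{-d}[X]$ with $\dim X-d\le -m$. Put $[n]_{\mathbb L}=1+\mathbb L+\cdots+\mathbb L^{n-1}$ and $[n]_{\mathbb L}!=[1]_{\mathbb L}[2]_{\mathbb L}\cdots[n]_{\mathbb L}$. For $n\ge 0$ let $Quad_n\simeq\mathbb A_k^{\binom{n+1}{2}}$ be the affine space of quadratic forms on $k^n$. The rank of a quadratic form $Q$ on $V$ is $\dim V-\dim\operatorname{rad}_Q$, where $\operatorname{rad}_Q=\{v\in V: Q(v+w)=Q(v)+Q(w)\text{ for all }w\in V\}$. Let $Quad_{n,n}\subset Quad_n$ be the open subvariety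 of forms of rank $n$. Then every $[n]_{\mathbb L}!$ is a unit of $\hat K_0(Var_k)$, and, in the ring of formal power series in $x$ over $\hat K_0(Var_k)$, $$\sum_{n\ge 0}\frac{[Quad_{n,n}]\,x^n}{[n]_{\mathbb L}!}=P_{\rm even}(x)+P_{\rm odd}(x),$$ where $$P_{\rm even}(x)=\sum_{r\ge 0}\frac{x^{2r}}{[2r]_{\mathbb L}!}\prod_{i=1}^{r}\left(\mathbb L^{2r+1}-\mathbb L^{2i}\right),\qquad P_{\rm odd}(x)=\sum_{r\ge 0}\frac{x^{2r+1}}{[2r+1]_{\mathbb L}!}\prod_{i=0}^{r}\left(\mathbb L^{2r+1}-\mathbb L^{2i}\right).$$ Equivalently, for every $r\ge 0$, the following equalities hold in $\hat K_0(Var_k)$: $$[Quad_{2r+1,2r+1}]=\prod_{i=0}^{r}\left(\mathbb L^{2r+1}-\mathbb L^{2i}\right),\qquad [Quad_{2r,2r}]=\prod_{i=1}^{r}\left(\mathbb L^{2r+1}-\mathbb L^{2i}\right).$$ -/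

import Mathlib

universe u

namespace Motivic

open CategoryTheory AlgebraicGeometry Limits

/-! ### Krull dimension of schemes of finite type over a field

These facts are what makes the dimensional filtration compatible with products. -/

section Dimension
open TensorProduct

theorem ringKrullDim_le_of_integral {A B : Type*} [CommRing A] [CommRing B] [Algebra A B]
    [Algebra.IsIntegral A B] : ringKrullDim B ≤ ringKrullDim A :=
  Order.krullDim_le_of_strictMono (PrimeSpectrum.comap (algebraMap A B))
    (fun _ _ h => Ideal.IsIntegral.comap_lt_comap h)

theorem le_ringKrullDim_of_integral {A B : Type*} [CommRing A] [CommRing B] [Algebra A B]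
    [Algebra.IsIntegral A B] (hinj : Function.Injective (algebraMap A B)) :
    ringKrullDim A ≤ ringKrullDim B := by
  refine iSup_le fun l => ?_
  obtain ⟨P, -, _, hPl⟩ := Ideal.exists_ideal_over_prime_of_isIntegral (S := B) l.head.asIdeal ⊥
    (by rw [← RingHom.ker_eq_comap_bot, (RingHom.injective_iff_ker_eq_bot _).1 hinj]; exact bot_le)
  have : P.LiesOver l.head.asIdeal := ⟨hPl.symm⟩
  obtain ⟨L, hL, -⟩ := Ideal.exists_ltSeries_of_hasGoingUp l P
  exact hL ▸ Order.LTSeries.length_le_krullDim L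

theorem exists_ringKrullDim_le_of_finiteType (k A : Type*) [Field k] [CommRing A] [Algebra k A]
    [Algebra.FiniteType k A] : ∃ N : ℕ, ringKrullDim A ≤ N := by
  obtain ⟨n, f, hf⟩ := Algebra.FiniteType.iff_quotient_mvPolynomial''.mp ‹Algebra.FiniteType k A›
  refine ⟨n, (ringKrullDim_le_of_surjective f.toRingHom hf).trans ?_⟩
  simp [MvPolynomial.ringKrullDim_of_isNoetherianRing]

theorem ringKrullDim_tensorProduct_le (k A B : Type*) [Field k] [CommRing A] [CommRing B]
    [Algebra k A] [Algebra k B] [Algebra.FiniteType k A] [Algebra.FiniteType k B] :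
    ringKrullDim (A ⊗[k] B) ≤ ringKrullDim A + ringKrullDim B := by
  rcases subsingleton_or_nontrivial A with hA | hA
  · have : Subsingleton (A ⊗[k] B) := inferInstance
    rw [ringKrullDim_eq_bot_of_subsingleton]
    exact bot_le
  obtain ⟨s, g, ginj, gint⟩ := exists_integral_inj_algHom_of_fg k A
  have hs : (s : WithBot ℕ∞) ≤ ringKrullDim A := by
    let := g.toRingHom.toAlgebra
    have : Algebra.IsIntegral (MvPolynomial (Fin s) k) A := ⟨gint⟩
    have := le_ringKrullDim_of_integral (A := MvPolynomial (Fin s) k) (B := A) ginj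
    simpa [MvPolynomial.ringKrullDim_of_isNoetherianRing] using this
  have h2 : ringKrullDim (A ⊗[k] B) ≤ ringKrullDim (MvPolynomial (Fin s) k ⊗[k] B) := by
    let φ := Algebra.TensorProduct.map g (AlgHom.id k B)
    let := φ.toRingHom.toAlgebra
    have : Algebra.IsIntegral (MvPolynomial (Fin s) k ⊗[k] B) (A ⊗[k] B) := by
      refine ⟨fun z => ?_⟩
      induction z with
      | zero => exact isIntegral_zero
      | add x y hx hy => exact hx.add hy
      | tmul a b =>
        have hb : IsIntegral (MvPolynomial (Fin s) k ⊗[k] B) ((1 : A) ⊗ₜ[k] b) := by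
          have : (1 : A) ⊗ₜ[k] b = algebraMap (MvPolynomial (Fin s) k ⊗[k] B) (A ⊗[k] B)
              (1 ⊗ₜ b) := by
            change _ = φ (1 ⊗ₜ b)
            simp [φ]
          rw [this]
          exact isIntegral_algebraMap
        have ha : IsIntegral (MvPolynomial (Fin s) k ⊗[k] B) (a ⊗ₜ[k] (1 : B)) := by
          obtain ⟨p, hp, hpa⟩ := gint a
          refine ⟨p.map (Algebra.TensorProduct.includeLeftRingHom), hp.map _, ?_⟩
          have h : (algebraMap (MvPolynomial (Fin s) k ⊗[k] B) (A ⊗[k] B)).comp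
              Algebra.TensorProduct.includeLeftRingHom =
              (Algebra.TensorProduct.includeLeftRingHom (A := A) (B := B)).comp
                (g : MvPolynomial (Fin s) k →+* A) := by
            refine RingHom.ext fun q => ?_
            change φ (q ⊗ₜ 1) = g q ⊗ₜ 1
            simp [φ]
          rw [Polynomial.eval₂_map, h]
          have := congrArg (Algebra.TensorProduct.includeLeftRingHom (R := k) (A := A) (B := B)) hpa
          rw [Polynomial.hom_eval₂, map_zero] at this
          exact this
        have := ha.mul hb
        rwa [Algebra.TensorProduct.tmul_mul_tmul, mul_one, one_mul] at this
    exact ringKrullDim_le_of_integral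
  have : IsNoetherianRing B := Algebra.FiniteType.isNoetherianRing k B
  have h3 : ringKrullDim (MvPolynomial (Fin s) k ⊗[k] B) = ringKrullDim B + s := by
    have e : MvPolynomial (Fin s) k ⊗[k] B ≃+* MvPolynomial (Fin s) B :=
      ((Algebra.TensorProduct.comm k _ _).toRingEquiv).trans
        (MvPolynomial.algebraTensorAlgEquiv k B).toRingEquiv
    rw [ringKrullDim_eq_of_ringEquiv e]
    simp [MvPolynomial.ringKrullDim_of_isNoetherianRing]
  rw [h3, add_comm] at h2
  exact h2.trans (by gcongr)

attribute [local instance] specializationOrder in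
theorem topologicalKrullDim_eq_iSup_coheight (X : Scheme.{u}) :
    topologicalKrullDim X = ⨆ x : X, ((Order.coheight x : ℕ∞) : WithBot ℕ∞) := by
  rw [← Order.krullDim_eq_iSup_coheight]
  exact Order.krullDim_eq_of_orderIso (irreducibleSetEquivPoints (α := X))

theorem topologicalKrullDim_le_of_cover (X : Scheme.{u}) (c : WithBot ℕ∞)
    (h : ∀ x : X, ∃ (U : Scheme.{u}) (f : U ⟶ X), IsOpenImmersion f ∧ x ∈ Set.range f ∧
      topologicalKrullDim U ≤ c) : topologicalKrullDim X ≤ c := by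
  rw [topologicalKrullDim_eq_iSup_coheight]
  refine iSup_le fun x => ?_
  obtain ⟨U, f, hf, ⟨y, rfl⟩, hU⟩ := h x
  rw [topologicalKrullDim_eq_iSup_coheight] at hU
  rw [show Order.coheight (f y) = _ from coheight_eq_of_isOpenImmersion f]
  exact (le_iSup (fun y : U => ((Order.coheight y : ℕ∞) : WithBot ℕ∞)) y).trans hU

theorem topologicalKrullDim_spec (R : Type u) [CommRing R] :
    topologicalKrullDim (Spec (.of R)) = ringKrullDim R :=
  PrimeSpectrum.topologicalKrullDim_eq_ringKrullDim R

theorem exists_finiteType_of_spec (k : Type u) [Field k] {R : CommRingCat.{u}}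
    (f : Spec R ⟶ Spec (.of k)) [LocallyOfFiniteType f] :
    ∃ a : k →+* R, a.FiniteType ∧ f = Spec.map (CommRingCat.ofHom a) := by
  obtain ⟨a, rfl⟩ := Spec.map_surjective f
  exact ⟨a.hom, (HasRingHomProperty.Spec_iff (P := @LocallyOfFiniteType)).1 inferInstance, rfl⟩

theorem exists_topologicalKrullDim_le_of_isAffine (k : Type u) [Field k] (U : Scheme.{u})
    [IsAffine U] (f : U ⟶ Spec (.of k)) [LocallyOfFiniteType f] :
    ∃ N : ℕ, topologicalKrullDim U ≤ N := by
  obtain ⟨a, ha, -⟩ := exists_finiteType_of_spec k (U.isoSpec.inv ≫ f)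
  let _ := a.toAlgebra
  have : Algebra.FiniteType k Γ(U, ⊤) := ha
  obtain ⟨N, hN⟩ := exists_ringKrullDim_le_of_finiteType k Γ(U, ⊤)
  refine ⟨N, ?_⟩
  rw [(Scheme.homeoOfIso U.isoSpec).isHomeomorph.topologicalKrullDim_eq]
  exact (topologicalKrullDim_spec _).trans_le hN

theorem exists_topologicalKrullDim_le (k : Type u) [Field k] (X : Scheme.{u})
    (f : X ⟶ Spec (.of k)) [LocallyOfFiniteType f] [QuasiCompact f] :
    ∃ N : ℕ, topologicalKrullDim X ≤ N := by
  have : CompactSpace X := (quasiCompact_iff_compactSpace f).1 inferInstance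
  have hb : ∀ i, ∃ N : ℕ, topologicalKrullDim (X.affineCover.finiteSubcover.X i) ≤ N := fun i =>
    have : IsAffine (X.affineCover.finiteSubcover.X i) :=
      inferInstanceAs (IsAffine (X.affineCover.X _))
    exists_topologicalKrullDim_le_of_isAffine k _ (X.affineCover.finiteSubcover.f i ≫ f)
  choose N hN using hb
  refine ⟨Finset.univ.sup N, topologicalKrullDim_le_of_cover X _ fun x => ?_⟩
  obtain ⟨i, hi⟩ := X.affineCover.finiteSubcover.exists_eq x
  refine ⟨_, X.affineCover.finiteSubcover.f i, inferInstance, hi, (hN i).trans ?_⟩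
  exact_mod_cast Finset.le_sup (f := N) (Finset.mem_univ i)

theorem topologicalKrullDim_pullback_le (k : Type u) [Field k] {X Y : Scheme.{u}}
    (f : X ⟶ Spec (.of k)) (g : Y ⟶ Spec (.of k))
    [LocallyOfFiniteType f] [LocallyOfFiniteType g] :
    topologicalKrullDim (pullback f g : Scheme.{u}) ≤
      topologicalKrullDim X + topologicalKrullDim Y := by
  refine topologicalKrullDim_le_of_cover _ _ fun z => ?_
  obtain ⟨R, i, hi, hxi, -⟩ := Scheme.exists_affine_mem_range_and_range_subset
      (show pullback.fst f g z ∈ (⊤ : X.Opens) from trivial)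
  obtain ⟨S, j, hj, hyj, -⟩ := Scheme.exists_affine_mem_range_and_range_subset
      (show pullback.snd f g z ∈ (⊤ : Y.Opens) from trivial)
  refine ⟨_, pullback.map (i ≫ f) (j ≫ g) f g i j (𝟙 _) (by simp) (by simp), inferInstance, ?_, ?_⟩
  · rw [Scheme.Pullback.range_map]
    exact ⟨hxi, hyj⟩
  · obtain ⟨a, fa, ha⟩ := exists_finiteType_of_spec k (i ≫ f)
    obtain ⟨b, fb, hb⟩ := exists_finiteType_of_spec k (j ≫ g)
    let _ := a.toAlgebra
    let _ := b.toAlgebra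
    have : Algebra.FiniteType k R := fa
    have : Algebra.FiniteType k S := fb
    rw [ha, hb]
    have h1 := (Scheme.homeoOfIso (pullbackSpecIso k R S)).isHomeomorph.topologicalKrullDim_eq
    refine h1.trans_le ?_
    rw [topologicalKrullDim_spec]
    refine (ringKrullDim_tensorProduct_le k R S).trans ?_
    gcongr
    · exact (topologicalKrullDim_spec R).symm.trans_le
        i.isOpenEmbedding.isInducing.topologicalKrullDim_le
    · exact (topologicalKrullDim_spec S).symm.trans_le
        j.isOpenEmbedding.isInducing.topologicalKrullDim_le

end Dimension

/-! ### Varieties -/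

/-- A `k`-variety is a separated scheme of finite type over `k`
(possibly reducible, non-reduced or empty). -/
def IsVariety (k : Type u) [Field k] : ObjectProperty (Over (Spec (.of k))) := fun X =>
  LocallyOfFiniteType X.hom ∧ QuasiCompact X.hom ∧ IsSeparated X.hom

instance (k : Type u) [Field k] : (IsVariety k).IsMonoidal where
  prop_unit := by
    exact ⟨inferInstanceAs (LocallyOfFiniteType (𝟙 (Spec (.of k)))),
      inferInstanceAs (QuasiCompact (𝟙 (Spec (.of k)))),
      inferInstanceAs (IsSeparated (𝟙 (Spec (.of k))))⟩
  prop_tensor X Y hX hY := by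
    obtain ⟨h1, h2, h3⟩ := hX
    obtain ⟨h4, h5, h6⟩ := hY
    refine ⟨?_, ?_, ?_⟩ <;> rw [Over.tensorObj_hom] <;> infer_instance

/-- The category of `k`-varieties and `k`-morphisms; its tensor product is the fibre product
over `Spec k` and its unit is `Spec k`. -/
abbrev Variety (k : Type u) [Field k] := (IsVariety k).FullSubcategory

/-! ### Quadratic forms -/

/-- The quadratic form `v ↦ ∑_{i ≤ j} a_{ij} v_i v_j` on `R^n` with coefficients `a_{ij} = a s(i, j)`. -/
def quadraticForm {n : ℕ} {R : Type*} [CommRing R] (a : Sym2 (Fin n) → R) :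
    QuadraticForm R (Fin n → R) :=
  ∑ i, ∑ j ∈ Finset.Ici i,
    a s(i, j) • QuadraticMap.linMulLin (LinearMap.proj i) (LinearMap.proj j)

theorem quadraticForm_apply {n : ℕ} {R : Type*} [CommRing R] (a : Sym2 (Fin n) → R) (v : Fin n → R) :
    quadraticForm a v = ∑ i, ∑ j ∈ Finset.Ici i, a s(i, j) * (v i * v j) := by
  simp [quadraticForm]

/-- The Gram matrix of the polar form of `quadraticForm a`. -/
def polarMatrix {n : ℕ} {R : Type*} [CommRing R] (a : Sym2 (Fin n) → R) :
    Matrix (Fin n) (Fin n) R :=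
  Matrix.of fun i j => if i = j then 2 * a s(i, i) else a s(i, j)

theorem polarBilin_quadraticForm {n : ℕ} {R : Type*} [CommRing R] (a : Sym2 (Fin n) → R) :
    QuadraticMap.polarBilin (quadraticForm a) = Matrix.toLinearMap₂' R (polarMatrix a) := by
  refine LinearMap.ext₂ fun v w => ?_
  have h1 : ∀ v w : Fin n → R, ∑ i, ∑ j ∈ Finset.Ici i, a s(i, j) * (v i * w j) =
      ∑ i, ∑ j, if i ≤ j then a s(i, j) * (v i * w j) else 0 := fun v w => by
    refine Finset.sum_congr rfl fun i _ => ?_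
    rw [← Finset.sum_filter]
    refine Finset.sum_congr (by ext; simp) fun _ _ => rfl
  have h2 : ∑ i, ∑ j, (if i ≤ j then a s(i, j) * (w i * v j) else 0) =
      ∑ i, ∑ j, (if j ≤ i then a s(i, j) * (v i * w j) else 0) := by
    rw [Finset.sum_comm]
    refine Finset.sum_congr rfl fun i _ => Finset.sum_congr rfl fun j _ => ?_
    rw [Sym2.eq_swap, mul_comm (w j)]
  have h3 : QuadraticMap.polarBilin (quadraticForm a) v w =
      (∑ i, ∑ j ∈ Finset.Ici i, a s(i, j) * (v i * w j)) +
        ∑ i, ∑ j ∈ Finset.Ici i, a s(i, j) * (w i * v j) := by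
    simp only [QuadraticMap.polarBilin_apply_apply, QuadraticMap.polar, quadraticForm_apply,
      ← Finset.sum_sub_distrib, ← Finset.sum_add_distrib, Pi.add_apply]
    refine Finset.sum_congr rfl fun i _ => Finset.sum_congr rfl fun j _ => ?_
    ring
  rw [h3, h1, h1, h2, Matrix.toLinearMap₂'_apply, ← Finset.sum_add_distrib]
  refine Finset.sum_congr rfl fun i _ => ?_
  rw [← Finset.sum_add_distrib]
  refine Finset.sum_congr rfl fun j _ => ?_
  rcases lt_trichotomy i j with h | rfl | h
  · simp [polarMatrix, h.le, h.not_ge, h.ne]; ring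
  · simp [polarMatrix]; ring
  · simp [polarMatrix, h.le, h.not_ge, h.ne']; ring

/-- The radical `{v | Q (v + w) = Q v + Q w for all w}` of a quadratic form `Q`, see `mem_radical`. -/
def radical {K V : Type*} [Field K] [AddCommGroup V] [Module K V] (Q : QuadraticForm K V) :
    Submodule K V := LinearMap.ker Q.polarBilin

theorem mem_radical {K V : Type*} [Field K] [AddCommGroup V] [Module K V] {Q : QuadraticForm K V}
    {v : V} : v ∈ radical Q ↔ ∀ w, Q (v + w) = Q v + Q w := by
  simp only [radical, LinearMap.mem_ker, LinearMap.ext_iff, QuadraticMap.polarBilin_apply_apply,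
    QuadraticMap.polar, LinearMap.zero_apply, sub_sub, sub_eq_zero]

/-- The rank `dim V - dim rad Q` of a quadratic form `Q` on `V`. -/
noncomputable def rank {K V : Type*} [Field K] [AddCommGroup V] [Module K V]
    (Q : QuadraticForm K V) : ℕ :=
  Module.finrank K V - Module.finrank K (radical Q)

theorem rank_quadraticForm_eq_iff {n : ℕ} {K : Type*} [Field K] (a : Sym2 (Fin n) → K) :
    rank (quadraticForm a) = n ↔ (polarMatrix a).det ≠ 0 := by
  have h1 : rank (quadraticForm a) = n ↔ radical (quadraticForm a) = ⊥ := by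
    have := (radical (quadraticForm a)).finrank_le
    rw [rank, ← Submodule.finrank_eq_zero (R := K)]
    rw [Module.finrank_fin_fun] at *
    omega
  rw [h1, ← Matrix.separatingLeft_iff_det_ne_zero, ← Matrix.separatingLeft_toLinearMap₂'_iff (R := K),
    LinearMap.separatingLeft_iff_ker_eq_bot, radical, polarBilin_quadraticForm]

variable (k : Type u) [Field k]

/-- The coordinate ring `k[x_{ij} : i ≤ j]` of the affine space of quadratic forms on `k^n`. -/
abbrev QuadRing (n : ℕ) : Type u := MvPolynomial (Sym2 (Fin n)) k

/-- The quadratic form over the residue field `κ(p)` that corresponds to a point `p` of the affine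
space of quadratic forms: its coefficients are the values `x_{ij}(p)`. -/
noncomputable def formAt (n : ℕ) (p : PrimeSpectrum (QuadRing k n)) :
    QuadraticForm p.asIdeal.ResidueField (Fin n → p.asIdeal.ResidueField) :=
  quadraticForm fun s => algebraMap (QuadRing k n) p.asIdeal.ResidueField (MvPolynomial.X s)

theorem rank_formAt_eq_iff (n : ℕ) (p : PrimeSpectrum (QuadRing k n)) :
    rank (formAt k n p) = n ↔
      p ∈ PrimeSpectrum.basicOpen (polarMatrix (R := QuadRing k n) MvPolynomial.X).det := by
  rw [formAt, rank_quadraticForm_eq_iff, PrimeSpectrum.mem_basicOpen]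
  rw [← not_iff_not, not_not, not_not, ← Ideal.algebraMap_residueField_eq_zero, RingHom.map_det]
  have : (algebraMap (QuadRing k n) p.asIdeal.ResidueField).mapMatrix
      (polarMatrix (R := QuadRing k n) MvPolynomial.X) =
      polarMatrix fun s => algebraMap (QuadRing k n) p.asIdeal.ResidueField (MvPolynomial.X s) := by
    ext i j
    simp only [polarMatrix, RingHom.mapMatrix_apply, Matrix.map_apply, Matrix.of_apply]
    split_ifs
    · rw [map_mul, map_ofNat]
    · rfl
  rw [this]

/-- The open locus of forms of rank `n` in the affine space of quadratic forms on `k^n`. -/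
noncomputable def nondegenerateLocus (n : ℕ) : (Spec (.of (QuadRing k n))).Opens where
  carrier := {p : PrimeSpectrum (QuadRing k n) | rank (formAt k n p) = n}
  is_open' := by
    have : {p : PrimeSpectrum (QuadRing k n) | rank (formAt k n p) = n} =
        PrimeSpectrum.basicOpen (polarMatrix (R := QuadRing k n) MvPolynomial.X).det :=
      Set.ext fun p => rank_formAt_eq_iff k n p
    exact this ▸ (PrimeSpectrum.basicOpen _).isOpen

/-- The affine variety `Spec A` of a finitely generated `k`-algebra `A`. -/
noncomputable def specVariety (A : Type u) [CommRing A] [Algebra k A] [Algebra.FiniteType k A] :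
    Variety k where
  obj := Over.mk (Spec.map (CommRingCat.ofHom (algebraMap k A)))
  property := by
    refine ⟨?_, ?_, ?_⟩
    · exact (HasRingHomProperty.Spec_iff (P := @LocallyOfFiniteType)).2
        (RingHom.finiteType_algebraMap.2 inferInstance)
    · exact inferInstanceAs (QuasiCompact (Spec.map _))
    · exact inferInstanceAs (IsSeparated (Spec.map _))

/-- An open subvariety of a variety. -/
noncomputable def openSubvariety (X : Variety k) (U : X.obj.left.Opens) : Variety k where
  obj := Over.mk (U.ι ≫ X.obj.hom)
  property := by
    obtain ⟨h1, h2, h3⟩ := X.property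
    have : IsLocallyNoetherian X.obj.left := by
      exact LocallyOfFiniteType.isLocallyNoetherian X.obj.hom
    refine ⟨?_, ?_, ?_⟩
    · exact inferInstanceAs (LocallyOfFiniteType (U.ι ≫ X.obj.hom))
    · exact inferInstanceAs (QuasiCompact (U.ι ≫ X.obj.hom))
    · exact inferInstanceAs (IsSeparated (U.ι ≫ X.obj.hom))

/-- The affine line over `k`. -/
noncomputable def affineLine : Variety k := specVariety k (Polynomial k)

/-- The affine space `Quad_n` of quadratic forms on `k^n`. -/
noncomputable def quad (n : ℕ) : Variety k := specVariety k (QuadRing k n)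

/-- The subvariety `Quad_{n,n}` of `Quad_n` of quadratic forms of rank `n`. -/
noncomputable def quadNondeg (n : ℕ) : Variety k :=
  openSubvariety k (quad k n) (nondegenerateLocus k n)

/-! ### The Grothendieck ring of varieties and its dimensional completion -/

/-- The generator given by the isomorphism class of `X`. Products of isomorphism classes make the
free abelian group on them a commutative ring with unit the class of `Spec k`. -/
noncomputable def isoClass (X : Variety k) : FreeAbelianGroup (Skeleton (Variety k)) :=
  FreeAbelianGroup.of (toSkeleton X)

/-- The elements `[X] - ([X \ Z] + [Z])` for closed subvarieties `Z` of `X`; here `U` is the open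
complement `X \ Z`. -/
def scissorRelations : Set (FreeAbelianGroup (Skeleton (Variety k))) :=
  {x | ∃ (X U Z : Variety k) (j : U ⟶ X) (i : Z ⟶ X),
    IsOpenImmersion j.hom.left ∧ IsClosedImmersion i.hom.left ∧
    Set.range j.hom.left = (Set.range i.hom.left)ᶜ ∧
    x = isoClass k X - (isoClass k U + isoClass k Z)}

/-- The Grothendieck ring `K₀(Var_k)`. (The additive subgroup generated by the scissor relations is
stable under products with classes of varieties, so it is the ideal that they generate.) -/
abbrev K0Var : Type (u + 1) :=
  FreeAbelianGroup (Skeleton (Variety k)) ⧸ Ideal.span (scissorRelations k)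

variable {k} in
/-- The class of a variety in `K₀(Var_k)`. -/
noncomputable def classOf (X : Variety k) : K0Var k :=
  Ideal.Quotient.mk (Ideal.span (scissorRelations k)) (isoClass k X)

/-- The class of the affine line in `K₀(Var_k)`. -/
noncomputable def lefschetz : K0Var k := classOf (affineLine k)

/-- The localization `K₀(Var_k)[𝕃⁻¹]`. -/
def K0Loc : Type (u + 1) := Localization.Away (lefschetz k)

noncomputable instance : CommRing (K0Loc k) :=
  inferInstanceAs (CommRing (Localization.Away (lefschetz k)))

noncomputable instance : Algebra (K0Var k) (K0Loc k) :=
  inferInstanceAs (Algebra (K0Var k) (Localization.Away (lefschetz k)))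

instance : IsLocalization.Away (lefschetz k) (K0Loc k) :=
  inferInstanceAs (IsLocalization.Away (lefschetz k) (Localization.Away (lefschetz k)))

/-- The element `𝕃⁻¹` of `K₀(Var_k)[𝕃⁻¹]`. -/
noncomputable def lefschetzInv : K0Loc k := IsLocalization.Away.invSelf (lefschetz k)

/-- The dimensional filtration: `F^m` is the additive subgroup generated by the `𝕃^{-d} [X]` with
`dim X - d ≤ -m`. -/
noncomputable def dimFiltration (m : ℕ) : AddSubgroup (K0Loc k) :=
  AddSubgroup.closure {x | ∃ (X : Variety k) (d : ℕ),
    topologicalKrullDim X.obj.left + m ≤ d ∧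
    x = lefschetzInv k ^ d * algebraMap (K0Var k) (K0Loc k) (classOf X)}

theorem dimFiltration_antitone : Antitone (dimFiltration k) := by
  intro m m' h
  refine AddSubgroup.closure_mono ?_
  rintro x ⟨X, d, hd, rfl⟩
  refine ⟨X, d, le_trans ?_ hd, rfl⟩
  gcongr

variable {k} in
theorem classOf_mul (X Y : Variety k) :
    classOf (MonoidalCategoryStruct.tensorObj X Y) = classOf X * classOf Y := by
  rw [classOf, classOf, classOf, ← map_mul, isoClass, isoClass, isoClass, Skeleton.toSkeleton_tensorObj,
    FreeAbelianGroup.of_mul]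

theorem mul_mem_dimFiltration {m m' : ℕ} {x y : K0Loc k} (hx : x ∈ dimFiltration k m)
    (hy : y ∈ dimFiltration k m') : x * y ∈ dimFiltration k (m + m') := by
  induction hx using AddSubgroup.closure_induction with
  | zero => rw [zero_mul]; exact zero_mem _
  | add a b _ _ ha hb => rw [add_mul]; exact add_mem ha hb
  | neg a _ ha => rw [neg_mul]; exact neg_mem ha
  | mem a ha =>
    obtain ⟨X, d, hd, rfl⟩ := ha
    induction hy using AddSubgroup.closure_induction with
    | zero => rw [mul_zero]; exact zero_mem _
    | add a b _ _ ha hb => rw [mul_add]; exact add_mem ha hb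
    | neg a _ ha => rw [mul_neg]; exact neg_mem ha
    | mem b hb =>
      obtain ⟨Y, e, he, rfl⟩ := hb
      refine AddSubgroup.subset_closure ⟨MonoidalCategoryStruct.tensorObj X Y, d + e, ?_, ?_⟩
      · have h1 := X.property.1
        have h2 := Y.property.1
        have := topologicalKrullDim_pullback_le k X.obj.hom Y.obj.hom
        refine (add_le_add_left this _).trans ?_
        push_cast
        rw [add_add_add_comm]
        exact add_le_add hd he
      · rw [classOf_mul, map_mul, pow_add]
        ring

theorem exists_mul_mem_dimFiltration (x : K0Loc k) :
    ∃ c : ℕ, ∀ m, ∀ y ∈ dimFiltration k (m + c), x * y ∈ dimFiltration k m := by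
  obtain ⟨e, z, hz⟩ := IsLocalization.Away.surj (lefschetz k) x
  have hx : x = lefschetzInv k ^ e * algebraMap (K0Var k) (K0Loc k) z := by
    have h1 : algebraMap (K0Var k) (K0Loc k) (lefschetz k) * lefschetzInv k = 1 :=
      IsLocalization.Away.mul_invSelf _
    rw [← hz, mul_left_comm, ← mul_pow, mul_comm (lefschetzInv k), h1, one_pow, mul_one]
  subst hx
  clear hz
  obtain ⟨z, rfl⟩ := Ideal.Quotient.mk_surjective z
  have hneg : ∀ z : K0Var k,
      (∃ c : ℕ, ∀ m, ∀ y ∈ dimFiltration k (m + c),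
        lefschetzInv k ^ e * algebraMap (K0Var k) (K0Loc k) z * y ∈ dimFiltration k m) →
      ∃ c : ℕ, ∀ m, ∀ y ∈ dimFiltration k (m + c),
        lefschetzInv k ^ e * algebraMap (K0Var k) (K0Loc k) (-z) * y ∈ dimFiltration k m := by
    rintro z ⟨c, hc⟩
    refine ⟨c, fun m y hy => ?_⟩
    rw [map_neg, mul_neg, neg_mul]
    exact neg_mem (hc m y hy)
  induction z using FreeAbelianGroup.induction_on with
  | zero =>
    refine ⟨0, fun m y _ => ?_⟩
    rw [map_zero, map_zero, mul_zero, zero_mul]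
    exact zero_mem _
  | of s =>
    obtain ⟨X, rfl⟩ := Quotient.exists_rep s
    have h1 := X.property.1
    have h2 := X.property.2.1
    obtain ⟨N, hN⟩ := exists_topologicalKrullDim_le k X.obj.left X.obj.hom
    refine ⟨N, fun m y hy => ?_⟩
    induction hy using AddSubgroup.closure_induction with
    | zero => rw [mul_zero]; exact zero_mem _
    | add a b _ _ ha hb => rw [mul_add]; exact add_mem ha hb
    | neg a _ ha => rw [mul_neg]; exact neg_mem ha
    | mem b hb =>
      obtain ⟨Y, d, hd, rfl⟩ := hb
      refine AddSubgroup.subset_closure ⟨MonoidalCategoryStruct.tensorObj X Y, d + e, ?_, ?_⟩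
      · have h3 := Y.property.1
        have := topologicalKrullDim_pullback_le k X.obj.hom Y.obj.hom
        refine (add_le_add_left this _).trans ?_
        push_cast at hd ⊢
        refine le_trans ?_ (le_add_of_nonneg_right (by positivity))
        refine le_trans ?_ hd
        rw [add_comm (m : WithBot ℕ∞), ← add_assoc, add_comm (topologicalKrullDim _)]
        gcongr
      · rw [classOf_mul, map_mul, pow_add]
        change lefschetzInv k ^ e * algebraMap (K0Var k) (K0Loc k) (classOf X) * _ = _
        ring
  | neg s h => rw [map_neg]; exact hneg _ h
  | add a b ha hb =>
    obtain ⟨c, hc⟩ := ha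
    obtain ⟨c', hc'⟩ := hb
    refine ⟨max c c', fun m y hy => ?_⟩
    rw [map_add, map_add, mul_add, add_mul]
    exact add_mem (hc m y (dimFiltration_antitone k (by gcongr; exact le_max_left _ _) hy))
      (hc' m y (dimFiltration_antitone k (by gcongr; exact le_max_right _ _) hy))

theorem dimFiltration_basis : RingSubgroupsBasis (dimFiltration k) := by
  refine RingSubgroupsBasis.of_comm _ (fun i j => ⟨max i j, ?_⟩) (fun i => ⟨i, ?_⟩) fun x i => ?_
  · exact le_inf (dimFiltration_antitone k (le_max_left i j))
      (dimFiltration_antitone k (le_max_right i j))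
  · rintro _ ⟨x, hx, y, hy, rfl⟩
    exact dimFiltration_antitone k (Nat.le_add_right i i) (mul_mem_dimFiltration k hx hy)
  · obtain ⟨c, hc⟩ := exists_mul_mem_dimFiltration k x
    exact ⟨i + c, fun y hy => hc i y hy⟩

/-- The topology in which the subgroups `F^m` form a basis of neighbourhoods of zero. -/
noncomputable instance : TopologicalSpace (K0Loc k) := (dimFiltration_basis k).topology

instance : IsTopologicalRing (K0Loc k) :=
  (dimFiltration_basis k).toRingFilterBasis.isTopologicalRing

noncomputable instance : UniformSpace (K0Loc k) := IsTopologicalAddGroup.rightUniformSpace (K0Loc k)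

instance : IsUniformAddGroup (K0Loc k) := isUniformAddGroup_of_addCommGroup

/-- The completion of `K₀(Var_k)[𝕃⁻¹]` with respect to the dimensional filtration. -/
abbrev K0Hat : Type (u + 1) := UniformSpace.Completion (K0Loc k)

variable {k} in
/-- The class `[X]` of a variety in the completed ring. -/
noncomputable def motive (X : Variety k) : K0Hat k :=
  ((algebraMap (K0Var k) (K0Loc k) (classOf X) : K0Loc k) : K0Hat k)

/-- The Lefschetz motive `𝕃` in the completed ring. -/
noncomputable def L : K0Hat k := motive (affineLine k)

/-! ### Gaussian factorials and generating functions -/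

/-- The Gaussian polynomial `[n]_q = 1 + q + ⋯ + q^(n-1)`. -/
def gaussInt {R : Type*} [CommRing R] (q : R) (n : ℕ) : R := ∑ i ∈ Finset.range n, q ^ i

/-- The Gaussian factorial `[n]_q! = [1]_q [2]_q ⋯ [n]_q`. -/
def gaussFactorial {R : Type*} [CommRing R] (q : R) (n : ℕ) : R :=
  ∏ i ∈ Finset.Icc 1 n, gaussInt q i

/-- `G(x) = ∑_n [Quad_{n,n}] x^n / [n]_𝕃!`. -/
noncomputable def G : PowerSeries (K0Hat k) :=
  PowerSeries.mk fun n => motive (quadNondeg k n) * Ring.inverse (gaussFactorial (L k) n)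

/-- `P_even(x) = ∑_r x^(2r) / [2r]_𝕃! ∏_{i=1}^r (𝕃^(2r+1) - 𝕃^(2i))`; the coefficient of `x^n`
is given with `r = n / 2` for `n` even. -/
noncomputable def PEven : PowerSeries (K0Hat k) :=
  PowerSeries.mk fun n =>
    if Even n then
      Ring.inverse (gaussFactorial (L k) n) *
        ∏ i ∈ Finset.Icc 1 (n / 2), (L k ^ (2 * (n / 2) + 1) - L k ^ (2 * i))
    else 0

/-- `P_odd(x) = ∑_r x^(2r+1) / [2r+1]_𝕃! ∏_{i=0}^r (𝕃^(2r+1) - 𝕃^(2i))`; the coefficient of `x^n`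
is given with `r = n / 2` for `n` odd. -/
noncomputable def POdd : PowerSeries (K0Hat k) :=
  PowerSeries.mk fun n =>
    if Odd n then
      Ring.inverse (gaussFactorial (L k) n) *
        ∏ i ∈ Finset.Icc 0 (n / 2), (L k ^ (2 * (n / 2) + 1) - L k ^ (2 * i))
    else 0

end Motivic

namespace Motivic

open CategoryTheory AlgebraicGeometry Limits
open scoped TensorProduct

/-! ### Classes of affine varieties and of their basic open subsets -/

section AffineClasses

variable {k : Type u} [Field k]

/-! Since 2 is invertible, rescaling the diagonal coefficients identifies `Quad_{n,n}` with the
variety of invertible symmetric matrices, whose class `N n` (`nondegClass`) is found by Gaussian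
elimination carried out on varieties. Border a symmetric matrix `S` of size n by a corner `a` and a
row `b`. Where `a` is invertible, the Schur complement followed by a translation of `S` turns the
condition into invertibility of a generic `S`; this contributes `𝕃^n (𝕃 - 1) N n`. Where `a = 0`,
some entry of `b` must be nonzero, and it gives an invertible 2 × 2 pivot; this contributes `(𝕃^n -
1) 𝕃^n N (n - 1)`. The resulting two-term recursion `nondegClass_add_two` has the stated products as
its solution (`eq_prod_of_recursion`).

All cuts are of the form `f = 0` against `f` invertible on an affine scheme, so only classes of
algebras and their localizations occur. The locus `b ≠ 0`, which need not be affine, is handled by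
peeling off one entry of `b` at a time (`borderedClass_zero_extend`).

The product formulas already hold in `K0Var k`. The completion serves to make the Gaussian
factorials units: `𝕃^n - 1 = 𝕃^n (1 - 𝕃^{-n})`, and the geometric series in `𝕃^{-n}` converges
(`isUnit_one_sub_of_mem_dimFiltration`). The generating function identity is then a comparison of
coefficients. -/

instance finiteType_tensorProduct (A B : Type u) [CommRing A] [Algebra k A]
    [Algebra.FiniteType k A] [CommRing B] [Algebra k B] [Algebra.FiniteType k B] :
    Algebra.FiniteType k (A ⊗[k] B) :=
  Algebra.FiniteType.trans (S := A) ‹_› inferInstance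

variable (k) in
/-- The class of `Spec A` in the Grothendieck ring. -/
noncomputable def affineClass (A : Type u) [CommRing A] [Algebra k A] [Algebra.FiniteType k A] :
    K0Var k := classOf (specVariety k A)

variable (k) in
/-- The class of the basic open subset `D(g)` of `Spec A` in the Grothendieck ring. -/
noncomputable def basicOpenClass {A : Type u} [CommRing A] [Algebra k A] [Algebra.FiniteType k A]
    (g : A) : K0Var k := affineClass k (Localization.Away g)

variable {A B : Type u} [CommRing A] [Algebra k A] [Algebra.FiniteType k A]
  [CommRing B] [Algebra k B] [Algebra.FiniteType k B]

theorem classOf_congr {X Y : Variety k} (e : X ≅ Y) : classOf X = classOf Y := by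
  rw [classOf, classOf, isoClass, isoClass, congr_toSkeleton_of_iso e]

/-- The morphism of varieties induced by a homomorphism of algebras. -/
noncomputable def specMap (φ : A →ₐ[k] B) : specVariety k B ⟶ specVariety k A :=
  ObjectProperty.homMk (Over.homMk (Spec.map (CommRingCat.ofHom φ.toRingHom)) (by
    change Spec.map _ ≫ Spec.map _ = Spec.map _
    rw [← Spec.map_comp, ← CommRingCat.ofHom_comp]
    congr 2
    exact φ.comp_algebraMap))

theorem specMap_comp {C : Type u} [CommRing C] [Algebra k C] [Algebra.FiniteType k C]
    (φ : A →ₐ[k] B) (ψ : B →ₐ[k] C) : specMap ψ ≫ specMap φ = specMap (ψ.comp φ) := by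
  ext : 2
  change Spec.map _ ≫ Spec.map _ = Spec.map _
  rw [← Spec.map_comp, ← CommRingCat.ofHom_comp]
  rfl

theorem specMap_id : specMap (AlgHom.id k A) = 𝟙 _ := by
  ext : 2
  change Spec.map _ = 𝟙 _
  exact Spec.map_id _

theorem affineClass_congr (e : A ≃ₐ[k] B) : affineClass k A = affineClass k B :=
  classOf_congr
    { hom := specMap e.symm.toAlgHom
      inv := specMap e.toAlgHom
      hom_inv_id := by
        rw [specMap_comp, ← specMap_id]; congr 1; ext x; exact e.symm_apply_apply x
      inv_hom_id := by
        rw [specMap_comp, ← specMap_id]; congr 1; ext x; exact e.apply_symm_apply x }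

theorem affineClass_tensorProduct :
    affineClass k (A ⊗[k] B) = affineClass k A * affineClass k B := by
  rw [affineClass, affineClass, affineClass, ← classOf_mul]
  refine classOf_congr (ObjectProperty.isoMk _ (Over.isoMk (pullbackSpecIso k A B).symm ?_))
  change (pullbackSpecIso k A B).inv ≫ (_ ≫ Spec.map (CommRingCat.ofHom (algebraMap k A))) = _
  erw [pullbackSpecIso_inv_fst_assoc]
  rw [← Spec.map_comp, ← CommRingCat.ofHom_comp]
  rfl

theorem classOf_tensorUnit : classOf (MonoidalCategoryStruct.tensorUnit (Variety k)) = 1 := by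
  rw [classOf, isoClass, ← Skeleton.one_eq, FreeAbelianGroup.of_one, map_one]

theorem specVariety_field_obj : (specVariety k k).obj = Over.mk (𝟙 (Spec (.of k))) := by
  change Over.mk _ = _
  congr 1
  exact Spec.map_id _

theorem tensorUnit_obj :
    (MonoidalCategoryStruct.tensorUnit (Variety k)).obj = Over.mk (𝟙 (Spec (.of k))) := rfl

theorem affineClass_field : affineClass k k = 1 :=
  (classOf_congr (ObjectProperty.isoMk _
    (eqToIso (specVariety_field_obj.trans tensorUnit_obj.symm)))).trans classOf_tensorUnit

/-- This is the scissor relation for `V(f)` and its complement `D(f)`, with `B` as any model of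
`A/(f)`. -/
theorem affineClass_eq_basicOpenClass_add (f : A) (π : A →ₐ[k] B) (hπ : Function.Surjective π)
    (hker : RingHom.ker π = Ideal.span {f}) :
    affineClass k A = basicOpenClass k f + affineClass k B := by
  have : isoClass k (specVariety k A) -
      (isoClass k (specVariety k (Localization.Away f)) + isoClass k (specVariety k B)) ∈
      Ideal.span (scissorRelations k) := by
    refine Ideal.subset_span ⟨_, _, _, specMap (IsScalarTower.toAlgHom k A (Localization.Away f)),
      specMap π, ?_, ?_, ?_, rfl⟩
    · exact IsOpenImmersion.of_isLocalization (R := CommRingCat.of A) f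
    · exact IsClosedImmersion.spec_of_surjective (CommRingCat.ofHom π.toRingHom) hπ
    · refine (PrimeSpectrum.localization_away_comap_range (Localization.Away f) f).trans ?_
      refine Eq.trans ?_ (congrArg compl
        (range_comap_of_surjective _ π.toRingHom hπ).symm)
      change _ = (PrimeSpectrum.zeroLocus (RingHom.ker π : Set A))ᶜ
      rw [hker, PrimeSpectrum.zeroLocus_span, PrimeSpectrum.basicOpen_eq_zeroLocus_compl]
  have h := Ideal.Quotient.eq_zero_iff_mem.2 this
  rw [map_sub, map_add, sub_eq_zero] at h
  exact h

/-- Cutting the empty scheme by `f = 0` gives `[∅] = [∅] + [∅]`. -/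
theorem affineClass_of_subsingleton [Subsingleton A] : affineClass k A = 0 := by
  have h := affineClass_eq_basicOpenClass_add (0 : A) (AlgHom.id k A) Function.surjective_id
    (by simp; exact Subsingleton.elim _ _)
  have : Subsingleton (Localization.Away (0 : A)) :=
    (algebraMap A (Localization.Away (0 : A))).codomain_trivial
  have e : A ≃ₐ[k] Localization.Away (0 : A) :=
    AlgEquiv.ofBijective (IsScalarTower.toAlgHom k A _)
      ⟨fun _ _ _ => Subsingleton.elim _ _, fun y => ⟨0, Subsingleton.elim _ _⟩⟩
  rw [basicOpenClass, ← affineClass_congr e] at h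
  simpa using h

theorem basicOpenClass_zero : basicOpenClass k (0 : A) = 0 := by
  have : Subsingleton (Localization.Away (0 : A)) :=
    IsLocalization.subsingleton (M := Submonoid.powers (0 : A)) (Submonoid.mem_powers _)
  exact affineClass_of_subsingleton

theorem basicOpenClass_eq_affineClass (f : A) [Algebra A B] [IsScalarTower k A B]
    [IsLocalization.Away f B] : basicOpenClass k f = affineClass k B :=
  affineClass_congr ((IsLocalization.algEquiv (Submonoid.powers f)
    (Localization.Away f) B).restrictScalars k)

theorem basicOpenClass_of_isUnit {f : A} (hf : IsUnit f) : basicOpenClass k f = affineClass k A :=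
  have : IsLocalization.Away f A :=
    IsLocalization.away_of_isUnit_of_bijective A hf Function.bijective_id
  basicOpenClass_eq_affineClass f

/-- Asking only for associated elements allows unit factors, such as the determinant of a pivot
block, to be dropped. -/
theorem basicOpenClass_congr (e : A ≃ₐ[k] B) {f : A} {g : B} (h : Associated (e f) g) :
    basicOpenClass k f = basicOpenClass k g := by
  let _ : Algebra A (Localization.Away g) :=
    ((algebraMap B (Localization.Away g)).comp e.toRingHom).toAlgebra
  have : IsScalarTower k A (Localization.Away g) := .of_algebraMap_eq fun x => by
    change _ = algebraMap B (Localization.Away g) (e (algebraMap k A x))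
    rw [e.commutes, ← IsScalarTower.algebraMap_apply]
  have : IsLocalization.Away (e f) (Localization.Away g) := .of_associated h.symm
  have : IsLocalization.Away f (Localization.Away g) := by
    refine .mk _ (IsLocalization.Away.algebraMap_isUnit (e f)) (fun s => ?_) fun a b hab => ?_
    · obtain ⟨n, a, hn⟩ := IsLocalization.Away.surj (e f) s
      refine ⟨n, e.symm a, hn.trans ?_⟩
      change _ = algebraMap B _ (e (e.symm a))
      rw [e.apply_symm_apply]
    · obtain ⟨n, hn⟩ := IsLocalization.Away.exists_of_eq (x := e f) hab
      exact ⟨n, e.injective (by simpa using hn)⟩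
  exact basicOpenClass_eq_affineClass f

theorem basicOpenClass_mul (g f : A) : basicOpenClass k (g * f) =
    basicOpenClass k (algebraMap A (Localization.Away g) f) := by
  have : IsLocalization.Away (g * f)
      (Localization.Away (algebraMap A (Localization.Away g) f)) :=
    IsLocalization.Away.mul' (Localization.Away g) _ g f
  exact basicOpenClass_eq_affineClass _

/-- The scissor relation that cuts `D(g)` by `f = 0`. The localization and the quotient are
arbitrary models, so that polynomial rings over `A_f` and `A/(f)` can be inserted later. -/
theorem basicOpenClass_eq_add (g f : A) {A₁ A₂ : Type u}
    [CommRing A₁] [Algebra k A₁] [Algebra.FiniteType k A₁]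
    [CommRing A₂] [Algebra k A₂] [Algebra.FiniteType k A₂]
    [Algebra A A₁] [IsScalarTower k A A₁] [IsLocalization.Away f A₁]
    (π : A →ₐ[k] A₂) (hπ : Function.Surjective π) (hker : RingHom.ker π = Ideal.span {f}) :
    basicOpenClass k g = basicOpenClass k (algebraMap A A₁ g) + basicOpenClass k (π g) := by
  -- Localizing at `f` and then at `g`, or in the other order, gives the same open set `D(fg)`.
  have h1 : basicOpenClass k (algebraMap A A₁ g) =
      basicOpenClass k (algebraMap A (Localization.Away g) f) := by
    rw [← basicOpenClass_mul, mul_comm]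
    have : IsLocalization.Away (f * g) (Localization.Away (algebraMap A A₁ g)) :=
      IsLocalization.Away.mul' A₁ _ f g
    exact (basicOpenClass_eq_affineClass _).symm
  rw [h1]
  refine affineClass_eq_basicOpenClass_add _ (Localization.awayMapₐ π g)
    (IsLocalization.Away.mapₐ_surjective_of_surjective _ hπ) ?_
  refine (IsLocalization.ker_map (S := Localization.Away g) (Localization.Away (π g)) π.toRingHom
    (Submonoid.map_powers π.toRingHom g)).trans ?_
  change (RingHom.ker π).map _ = _
  rw [hker, Ideal.map_span, Set.image_singleton]

end AffineClasses

/-! ### Polynomial extensions and base change -/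

section PolynomialExtensions

variable {k : Type u} [Field k]

instance finiteType_mvPolynomial (σ : Type) [Finite σ] (A : Type u) [CommRing A] [Algebra k A]
    [Algebra.FiniteType k A] : Algebra.FiniteType k (MvPolynomial σ A) :=
  Algebra.FiniteType.trans (S := A) ‹_› inferInstance

instance finiteType_polynomial (A : Type u) [CommRing A] [Algebra k A]
    [Algebra.FiniteType k A] : Algebra.FiniteType k (Polynomial A) :=
  Algebra.FiniteType.trans (S := A) ‹_› inferInstance

variable (A : Type u) [CommRing A] [Algebra k A] [Algebra.FiniteType k A]

theorem affineClass_polynomial :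
    affineClass k (Polynomial A) = affineClass k A * lefschetz k :=
  (affineClass_congr (polyEquivTensor k A)).trans affineClass_tensorProduct

theorem affineClass_mvPolynomial (σ : Type) [Finite σ] :
    affineClass k (MvPolynomial σ A) = affineClass k A * lefschetz k ^ Nat.card σ := by
  suffices H : ∀ h : Finite σ, affineClass k (MvPolynomial σ A) =
      affineClass k A * lefschetz k ^ Nat.card σ from H ‹_›
  refine Finite.induction_empty_option (P := fun σ : Type => ∀ h : Finite σ,
    affineClass k (MvPolynomial σ A) = affineClass k A * lefschetz k ^ Nat.card σ) ?_ ?_ ?_ σ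
  · intro α β e ih _
    have := Finite.of_equiv β e.symm
    rw [← Nat.card_congr e, ← ih this]
    exact (affineClass_congr ((MvPolynomial.renameEquiv A e).restrictScalars k)).symm
  · intro _
    rw [Nat.card_eq_zero.2 (.inl inferInstance), pow_zero, mul_one]
    exact affineClass_congr ((MvPolynomial.isEmptyAlgEquiv A _).restrictScalars k)
  · intro α _ ih _
    rw [Finite.card_option, pow_succ, ← mul_assoc, ← ih inferInstance, ← affineClass_polynomial]
    exact affineClass_congr ((MvPolynomial.optionEquivLeft A α).restrictScalars k)

theorem basicOpenClass_polynomial_X :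
    basicOpenClass k (Polynomial.X : Polynomial A) = affineClass k A * (lefschetz k - 1) := by
  have h := affineClass_eq_basicOpenClass_add (Polynomial.X : Polynomial A)
    ((Polynomial.aeval (0 : A)).restrictScalars k)
    (fun a => ⟨Polynomial.C a, by simp⟩) (by
      rw [← Polynomial.ker_constantCoeff]
      ext p
      simp [-Polynomial.ker_constantCoeff, RingHom.mem_ker, Polynomial.coeff_zero_eq_eval_zero])
  rw [affineClass_polynomial] at h
  rw [mul_sub, h]
  ring

/-- Localization commutes with base change, so this open set is the product of `Spec A` with the
open set `D(g)` over `k`. -/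
theorem basicOpenClass_map_algebraMap {σ : Type} [Finite σ] (g : MvPolynomial σ k) :
    basicOpenClass k (MvPolynomial.map (algebraMap k A) g) =
      affineClass k A * basicOpenClass k g := by
  have h1 : IsScalarTower k A (A ⊗[k] MvPolynomial σ k) := TensorProduct.isScalarTower_left
  have h2 : IsScalarTower k A (A ⊗[k] Localization.Away g) := TensorProduct.isScalarTower_left
  refine Eq.trans ?_ (affineClass_tensorProduct (A := A) (B := Localization.Away g))
  refine (basicOpenClass_congr ((MvPolynomial.algebraTensorAlgEquiv k A).restrictScalars k)
    (f := (1 : A) ⊗ₜ[k] g) ?_).symm.trans ?_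
  · simp
  · exact (affineClass_congr ((IsLocalization.Away.tensorProductEquivTMulRight k A g
      (Localization.Away g)).restrictScalars k)).symm

end PolynomialExtensions

/-! ### Generic symmetric matrices and bordering -/

section SymmetricMatrices

open MvPolynomial Matrix

/-- The symmetric matrix with entries `a s(i, j)`. -/
def symMatrix {ι R : Type*} (a : Sym2 ι → R) : Matrix ι ι R := .of fun i j => a s(i, j)

/-- The symmetric matrix with first row `(a, b)` and lower right block `S`. -/
def bordered {ι R : Type*} (a : R) (b : ι → R) (S : Matrix ι ι R) :
    Matrix (Unit ⊕ ι) (Unit ⊕ ι) R :=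
  fromBlocks (of fun _ _ => a) (of fun _ j => b j) (of fun i _ => b i) S

theorem bordered_map {ι R S : Type*} (a : R) (b : ι → R) (T : Matrix ι ι R) (φ : R → S) :
    (bordered a b T).map φ = bordered (φ a) (φ ∘ b) (T.map φ) :=
  fromBlocks_map _ _ _ _ _

/-- Unordered pairs in `Unit ⊕ ι` are unordered pairs in `ι`, pairs of the new point with
a point of `ι`, or the new point twice. -/
noncomputable def sym2SumUnitEquiv (ι : Type*) : Sym2 ι ⊕ Option ι ≃ Sym2 (Unit ⊕ ι) :=
  Equiv.ofBijective (Sum.elim (Sym2.map Sum.inr)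
    fun o => s(Sum.inl (), o.elim (Sum.inl ()) Sum.inr)) <| by
    constructor
    · rintro (x | _ | x) (y | _ | y) h
      · exact congrArg _ (Sym2.map.injective Sum.inr_injective h)
      · induction x with | _ x x' => simp at h
      · induction x with | _ x x' => simp at h
      · induction y with | _ y y' => simp at h
      · rfl
      · simp at h
      · induction y with | _ y y' => simp at h
      · simp at h
      · simpa using h
    · intro z
      induction z with | _ x y =>
      rcases x with x | x <;> rcases y with y | y
      · exact ⟨.inr none, rfl⟩
      · exact ⟨.inr (some y), rfl⟩
      · exact ⟨.inr (some x), Sym2.eq_swap⟩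
      · exact ⟨.inl s(x, y), rfl⟩

/-- A polynomial in the entries of a symmetric matrix of size `Unit ⊕ ι` is a polynomial in the
entries of its lower right block over the polynomial ring in the entries of its first row. -/
noncomputable def borderEquiv (ι : Type*) (R : Type*) [CommRing R] :
    MvPolynomial (Sym2 (Unit ⊕ ι)) R ≃ₐ[R] MvPolynomial (Sym2 ι) (MvPolynomial (Option ι) R) :=
  (renameEquiv R (sym2SumUnitEquiv ι).symm).trans (sumAlgEquiv R (Sym2 ι) (Option ι))

theorem borderEquiv_X (ι : Type*) (R : Type*) [CommRing R] :
    (symMatrix X).map (borderEquiv ι R) =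
      bordered (C (X none)) (fun i => C (X (some i))) (symMatrix X) := by
  have h1 (z : Sym2 ι) : borderEquiv ι R (X (z.map Sum.inr)) = X z := by
    have : (sym2SumUnitEquiv ι).symm (z.map Sum.inr) = .inl z := by
      rw [Equiv.symm_apply_eq]; rfl
    simp [borderEquiv, this]
  have h2 (o : Option ι) : borderEquiv ι R (X s(Sum.inl (), o.elim (Sum.inl ()) Sum.inr)) =
      C (X o) := by
    have : (sym2SumUnitEquiv ι).symm s(Sum.inl (), o.elim (Sum.inl ()) Sum.inr) = .inr o := by
      rw [Equiv.symm_apply_eq]; rfl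
    simp [borderEquiv, this]
  ext1 (i | i) (j | j)
  · exact h2 none
  · exact h2 (some j)
  · refine Eq.trans ?_ (h2 (some i))
    exact congrArg (fun z => borderEquiv ι R (X z)) Sym2.eq_swap
  · exact h1 s(i, j)

end SymmetricMatrices

/-! ### Elimination with an invertible pivot block -/

section Recursion

open MvPolynomial Matrix

variable {k : Type u} [Field k]

variable (k) in
/-- The class of the variety of symmetric matrices over `ι` with invertible determinant. -/
noncomputable def nondegClass (ι : Type) [Fintype ι] [DecidableEq ι] : K0Var k :=
  basicOpenClass k (symMatrix (X : Sym2 ι → MvPolynomial (Sym2 ι) k)).det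

variable {ι κ : Type} [Fintype ι] [DecidableEq ι] [Fintype κ] [DecidableEq κ]
  {A B : Type u} [CommRing A] [Algebra k A] [Algebra.FiniteType k A]
  [CommRing B] [Algebra k B] [Algebra.FiniteType k B]

/-- Translation of the variables of a polynomial ring. -/
noncomputable def translateEquiv {σ R : Type*} [CommRing R] (s : σ → R) :
    MvPolynomial σ R ≃ₐ[R] MvPolynomial σ R :=
  AlgEquiv.ofAlgHom (aeval fun i => X i + C (s i)) (aeval fun i => X i - C (s i))
    (by ext i; simp) (by ext i; simp)

/-- Translation by the symmetric matrix `S` is an automorphism of the affine space of symmetric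
matrices over `A`, so the family is a product. -/
theorem basicOpenClass_det_add {u : A} (hu : IsUnit u) {S : Matrix ι ι A} (hS : S.IsSymm) :
    basicOpenClass k (C u * (symMatrix X + S.map C).det : MvPolynomial (Sym2 ι) A) =
      affineClass k A * nondegClass k ι := by
  rw [nondegClass, ← basicOpenClass_map_algebraMap]
  let s : Sym2 ι → A := Sym2.lift ⟨fun i j => S i j, fun i j => hS.apply j i⟩
  refine (basicOpenClass_congr ((translateEquiv s).restrictScalars k) ?_).symm
  rw [RingHom.map_det]
  have h : (translateEquiv s) ((map (algebraMap k A)).mapMatrix (symMatrix X)).det =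
      (symMatrix X + S.map C).det := by
    rw [AlgEquiv.map_det]
    congr 1
    ext i j : 1
    simp [symMatrix, translateEquiv, s]
  refine (Associated.of_eq h).trans ?_
  exact associated_unit_mul_right _ _ (hu.map C)

/-- A bijection of types induces a bijection of unordered pairs. -/
def sym2Congr {α β : Type*} (e : α ≃ β) : Sym2 α ≃ Sym2 β where
  toFun := Sym2.map e
  invFun := Sym2.map e.symm
  left_inv z := by simp [Sym2.map_map]
  right_inv z := by simp [Sym2.map_map]

theorem sym2Congr_apply {α β : Type*} (e : α ≃ β) (i j : α) :
    sym2Congr e s(i, j) = s(e i, e j) := rfl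

/-- The Schur complement formula. The pivot and the off-diagonal blocks come from the base `R`, so
the correction to `T` does too; this is what makes it a translation. -/
theorem det_fromBlocks_map {R S : Type*} [CommRing R] [CommRing S] (φ : R →+* S)
    {M : Matrix κ κ R} (hdet : IsUnit M.det) (N : Matrix κ ι R) (T : Matrix ι ι S) :
    (fromBlocks (M.map φ) (N.map φ) (Nᵀ.map φ) T).det =
      φ M.det * (T + (-(Nᵀ * M⁻¹ * N)).map φ).det := by
  let _ : Invertible (M.map φ) :=
    { invOf := M⁻¹.map φ
      invOf_mul_self := by
        rw [← Matrix.map_mul, nonsing_inv_mul _ hdet, Matrix.map_one _ (map_zero _) (map_one _)]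
      mul_invOf_self := by
        rw [← Matrix.map_mul, mul_nonsing_inv _ hdet, Matrix.map_one _ (map_zero _) (map_one _)] }
  have h : ⅟(M.map φ) = M⁻¹.map φ := rfl
  have hneg : (-(Nᵀ * M⁻¹ * N)).map φ = -(Nᵀ * M⁻¹ * N).map φ :=
    Matrix.ext fun _ _ => map_neg φ _
  rw [det_fromBlocks₁₁, h, hneg, Matrix.map_mul, Matrix.map_mul, sub_eq_add_neg, RingHom.map_det,
    RingHom.mapMatrix_apply]

/-- The correction term `Nᵀ M⁻¹ N` is symmetric, hence absorbed by a translation of the generic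
block; the factor `det M` is a unit. -/
theorem basicOpenClass_det_fromBlocks {M : Matrix κ κ A} (hM : M.IsSymm) (hdet : IsUnit M.det)
    (N : Matrix κ ι A) :
    basicOpenClass k
      (fromBlocks (M.map C) (N.map C) (Nᵀ.map C)
        (symMatrix (X : Sym2 ι → MvPolynomial (Sym2 ι) A))).det =
      affineClass k A * nondegClass k ι := by
  have hS : (-(Nᵀ * M⁻¹ * N)).IsSymm := by
    rw [Matrix.IsSymm, transpose_neg, transpose_mul, transpose_mul, transpose_transpose,
      transpose_nonsing_inv, hM, Matrix.mul_assoc]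
  rw [← basicOpenClass_det_add hdet hS, det_fromBlocks_map C hdet]

variable (k) in
/-- The class of the variety over `Spec A` of symmetric matrices `S` such that the matrix
`[[a, b], [bᵗ, S]]` is nondegenerate. -/
noncomputable def borderedClass (a : A) (b : ι → A) : K0Var k :=
  basicOpenClass k (bordered (C a) (fun i => C (b i))
    (symMatrix (X : Sym2 ι → MvPolynomial (Sym2 ι) A))).det

theorem borderedClass_of_isUnit {a : A} (ha : IsUnit a) (b : ι → A) :
    borderedClass k a b = affineClass k A * nondegClass k ι :=
  basicOpenClass_det_fromBlocks (κ := Unit) (M := of fun _ _ => a) rfl (by simpa) _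

theorem borderedClass_congr (e : A ≃ₐ[k] B) (a : A) (b : ι → A) :
    borderedClass k a b = borderedClass k (e a) (e ∘ b) := by
  refine basicOpenClass_congr (mapAlgEquiv (Sym2 ι) e) (.of_eq ?_)
  rw [AlgEquiv.map_det, AlgEquiv.mapMatrix_apply, bordered_map]
  congr 1
  congr 1
  · simp
  · ext1 i; simp
  · ext1 i j; simp [symMatrix]

theorem borderedClass_comp_equiv (e : κ ≃ ι) (a : A) (b : ι → A) :
    borderedClass k a (b ∘ e) = borderedClass k a b := by
  refine basicOpenClass_congr ((renameEquiv A (sym2Congr e)).restrictScalars k) (.of_eq ?_)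
  refine (AlgEquiv.map_det (renameEquiv A (sym2Congr e)) _).trans ?_
  rw [← det_submatrix_equiv_self (Equiv.sumCongr (Equiv.refl Unit) e)]
  congr 1
  ext1 (i | i) (j | j) <;> simp [bordered, symMatrix, sym2Congr_apply]

theorem borderedClass_eq_add (f : A) (a : A) (b : ι → A) {A₁ A₂ : Type u}
    [CommRing A₁] [Algebra k A₁] [Algebra.FiniteType k A₁]
    [CommRing A₂] [Algebra k A₂] [Algebra.FiniteType k A₂]
    [Algebra A A₁] [IsScalarTower k A A₁] [IsLocalization.Away f A₁]
    (π : A →ₐ[k] A₂) (hπ : Function.Surjective π) (hker : RingHom.ker π = Ideal.span {f}) :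
    borderedClass k a b = borderedClass k (algebraMap A A₁ a) (algebraMap A A₁ ∘ b) +
      borderedClass k (π a) (π ∘ b) := by
  let _ : Algebra (MvPolynomial (Sym2 ι) A) (MvPolynomial (Sym2 ι) A₁) := algebraMvPolynomial
  have hC : (algebraMap (MvPolynomial (Sym2 ι) A) (MvPolynomial (Sym2 ι) A₁)) =
      map (algebraMap A A₁) := rfl
  have : IsScalarTower k (MvPolynomial (Sym2 ι) A) (MvPolynomial (Sym2 ι) A₁) :=
    .of_algebraMap_eq fun x => by
      rw [hC, MvPolynomial.algebraMap_apply, MvPolynomial.algebraMap_apply, map_C,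
        ← IsScalarTower.algebraMap_apply]
  have : IsLocalization.Away (C f : MvPolynomial (Sym2 ι) A) (MvPolynomial (Sym2 ι) A₁) := by
    have := MvPolynomial.isLocalization (σ := Sym2 ι) (Submonoid.powers f) A₁
    rwa [Submonoid.map_powers] at this
  have h := basicOpenClass_eq_add (k := k) (bordered (C a) (fun i => C (b i))
    (symMatrix (X : Sym2 ι → MvPolynomial (Sym2 ι) A))).det (C f)
    (A₁ := MvPolynomial (Sym2 ι) A₁) (mapAlgHom (σ := Sym2 ι) π) (by
      exact map_surjective _ hπ) (by
      rw [ker_mapAlgHom]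
      change (RingHom.ker π).map C = _
      rw [hker, Ideal.map_span, Set.image_singleton])
  rw [borderedClass, h, RingHom.map_det, AlgHom.map_det]
  congr 3
  · refine (bordered_map _ _ _ _).trans ?_
    congr 1
    · simp
    · ext1 i; simp
    · ext1 i j; simp [symMatrix]
  · refine (bordered_map _ _ _ _).trans ?_
    congr 1
    · simp
    · ext1 i; simp
    · ext1 i j; simp [symMatrix]

theorem borderedClass_zero_zero : borderedClass k (0 : A) (0 : ι → A) = 0 := by
  rw [borderedClass, det_eq_zero_of_row_eq_zero (Sum.inl ()), basicOpenClass_zero]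
  rintro (j | j) <;> simp [bordered]

/-- The block `[[0, β], [β, x]]` with `β` a unit has determinant `-β²` and serves as pivot, whatever
`x` is. The first row of the generic block, `card κ + 1` free entries including `x`, moves into the
base and accounts for the power of `𝕃`. -/
theorem borderedClass_zero_of_isUnit {b : Unit ⊕ κ → A} (hb : IsUnit (b (.inl ()))) :
    borderedClass k 0 b =
      affineClass k A * lefschetz k ^ (Fintype.card κ + 1) * nondegClass k κ := by
  rw [borderedClass, ← Nat.card_eq_fintype_card, ← Finite.card_option, ← affineClass_mvPolynomial]
  let R := MvPolynomial (Option κ) A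
  rw [← basicOpenClass_det_fromBlocks (κ := Unit ⊕ Unit) (A := R)
    (M := bordered 0 (fun _ => C (b (.inl ()))) (of fun _ _ => X none))
    (N := of (Sum.elim (fun _ j => C (b (.inr j))) fun _ j => X (some j)))]
  · refine basicOpenClass_congr ((borderEquiv κ A).restrictScalars k) (.of_eq ?_)
    refine (AlgEquiv.map_det (borderEquiv κ A) _).trans ?_
    rw [← det_submatrix_equiv_self (Equiv.sumAssoc Unit Unit κ)]
    congr 1
    rw [AlgEquiv.mapMatrix_apply, bordered_map, borderEquiv_X]
    have hC (x : A) : borderEquiv κ A (C x) = C (C x) := (borderEquiv κ A).commutes x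
    ext1 ((i | i) | i) ((j | j) | j) <;> simp [bordered, hC]
  · ext1 (i | i) (j | j) <;> rfl
  · obtain ⟨c, hc⟩ := hb.exists_right_inv
    have hc' : (C (b (.inl ())) * C c : R) = 1 := by rw [← C_mul, hc, C_1]
    -- With `c = β⁻¹`, the inverse of `[[0, β], [β, x]]` is `[[-c²x, c], [c, 0]]`.
    refine isUnit_det_of_right_inverse
      (B := bordered (-(C c * C c * X none)) (fun _ => C c) (of fun _ _ => 0)) ?_
    ext1 (i | i) (j | j) <;> simp [bordered, Matrix.mul_apply, hc']
    linear_combination (-(C c * X none)) * hc'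

theorem nondegClass_sum_unit :
    nondegClass k (Unit ⊕ ι) =
      borderedClass k (X none : MvPolynomial (Option ι) k) fun i => X (some i) := by
  refine basicOpenClass_congr (borderEquiv ι k) (.of_eq ?_)
  rw [AlgEquiv.map_det, AlgEquiv.mapMatrix_apply, borderEquiv_X]

theorem nondegClass_congr (e : ι ≃ κ) : nondegClass k ι = nondegClass k κ := by
  refine basicOpenClass_congr (renameEquiv k (sym2Congr e)) (.of_eq ?_)
  rw [AlgEquiv.map_det, ← det_submatrix_equiv_self e]
  congr 1
  ext1 i j
  simp [symMatrix, sym2Congr_apply]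

end Recursion

/-! ### Stratification of the first row and the recursion -/

section Recursion

open MvPolynomial Matrix

variable {k : Type u} [Field k] {ι : Type} [Fintype ι] [DecidableEq ι]
  {A : Type u} [CommRing A] [Algebra k A] [Algebra.FiniteType k A]

theorem borderedClass_zero_of_isUnit_apply {n : ℕ} (hn : Fintype.card ι = n + 1) {b : ι → A}
    {j : ι} (hb : IsUnit (b j)) :
    borderedClass k 0 b = affineClass k A * lefschetz k ^ (n + 1) * nondegClass k (Fin n) := by
  obtain ⟨e₀⟩ : Nonempty (Unit ⊕ Fin n ≃ ι) := by
    rw [← Fintype.card_eq, hn]; simp [add_comm]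
  -- The swap moves the invertible entry to the first position.
  let e := e₀.trans (Equiv.swap (e₀ (.inl ())) j)
  have he : e (.inl ()) = j := by simp [e]
  rw [← borderedClass_comp_equiv e,
    borderedClass_zero_of_isUnit (by rwa [Function.comp_apply, he]), Fintype.card_fin]

/-- One coordinate of the base is cut into its invertible part and its zero locus. -/
theorem borderedClass_polynomial (a : Polynomial A) (b : ι → Polynomial A) :
    borderedClass k a b =
      borderedClass k (algebraMap _ (Localization.Away (Polynomial.X : Polynomial A)) a)
        (algebraMap _ (Localization.Away (Polynomial.X : Polynomial A)) ∘ b) +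
      borderedClass k (a.eval 0) (fun i => (b i).eval 0) := by
  rw [borderedClass_eq_add (A₁ := Localization.Away (Polynomial.X : Polynomial A)) Polynomial.X a b
    ((Polynomial.aeval (0 : A)).restrictScalars k) (fun a => ⟨Polynomial.C a, by simp⟩) (by
      rw [← Polynomial.ker_constantCoeff]
      ext p
      simp [-Polynomial.ker_constantCoeff, RingHom.mem_ker, Polynomial.coeff_zero_eq_eval_zero])]
  congr 2

theorem renameEquiv_comp_extend {ι α β : Type} (e : α ≃ β) {f : β → ι} (hf : f.Injective) :
    renameEquiv k e ∘ Function.extend (f ∘ e) (X : α → MvPolynomial α k) 0 =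
      Function.extend f (X : β → MvPolynomial β k) 0 := by
  ext1 i
  rw [Function.comp_apply]
  by_cases h : ∃ x, f x = i
  · obtain ⟨x, rfl⟩ := h
    obtain ⟨y, rfl⟩ := e.surjective x
    rw [hf.extend_apply]
    refine (congrArg _ ((hf.comp e.injective).extend_apply X 0 y)).trans ?_
    simp
  · rw [Function.extend_apply' _ _ _ h, Function.extend_apply']
    · simp
    · rintro ⟨x, rfl⟩
      exact h ⟨_, rfl⟩

theorem eval_optionEquivLeft_extend {ι α : Type} {f : Option α → ι} (hf : f.Injective) :
    (fun i => ((optionEquivLeft k α ∘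
      Function.extend f (X : Option α → MvPolynomial (Option α) k) 0) i).eval 0) =
      Function.extend (f ∘ some) (X : α → MvPolynomial α k) 0 := by
  have hfs : (f ∘ some).Injective := hf.comp (Option.some_injective α)
  ext1 i
  rw [Function.comp_apply]
  by_cases h : ∃ x, f x = i
  · obtain ⟨x | x, rfl⟩ := h
    · rw [hf.extend_apply, Function.extend_apply', optionEquivLeft_X_none]
      · simp
      · rintro ⟨x, hx⟩
        simpa using hf hx
    · rw [hf.extend_apply, optionEquivLeft_X_some, Polynomial.eval_C]
      exact (hfs.extend_apply X 0 x).symm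
  · rw [Function.extend_apply' _ _ _ h, Function.extend_apply']
    · simp
    · rintro ⟨x, rfl⟩
      exact h ⟨_, rfl⟩

/-- The row has free entries on the image of `f` and zeros elsewhere. Where the entry at `f none` is
invertible it supplies the pivot, the other entries being arbitrary; where it vanishes, a row with
one free entry fewer remains. -/
theorem borderedClass_zero_extend_option {n : ℕ} (hn : Fintype.card ι = n + 1) (α : Type)
    [Finite α] {f : Option α → ι} (hf : f.Injective) :
    borderedClass k 0 (Function.extend f (X : Option α → MvPolynomial (Option α) k) 0) =
      lefschetz k ^ Nat.card α * (lefschetz k - 1) * lefschetz k ^ (n + 1) *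
        nondegClass k (Fin n) +
      borderedClass k 0 (Function.extend (f ∘ some) (X : α → MvPolynomial α k) 0) := by
  have hu : IsUnit ((algebraMap _
      (Localization.Away (Polynomial.X : Polynomial (MvPolynomial α k))) ∘ optionEquivLeft k α ∘
      Function.extend f (X : Option α → MvPolynomial (Option α) k) 0) (f none)) := by
    rw [Function.comp_apply, Function.comp_apply, hf.extend_apply, optionEquivLeft_X_none]
    exact IsLocalization.Away.algebraMap_isUnit _
  rw [borderedClass_congr (optionEquivLeft k α), map_zero, borderedClass_polynomial, map_zero,
    Polynomial.eval_zero, eval_optionEquivLeft_extend hf, borderedClass_zero_of_isUnit_apply hn hu,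
    ← basicOpenClass, basicOpenClass_polynomial_X, affineClass_mvPolynomial, affineClass_field,
    one_mul]

/-- The contributions `𝕃^i (𝕃 - 1)` of the successive free entries telescope to `𝕃^(card τ) - 1`,
the class of nonzero rows. Rows with only part of their entries free are needed for the induction;
the recursion uses the case `f = id`. -/
theorem borderedClass_zero_extend {n : ℕ} (hn : Fintype.card ι = n + 1) (τ : Type) [Finite τ]
    {f : τ → ι} (hf : f.Injective) :
    borderedClass k 0 (Function.extend f (X : τ → MvPolynomial τ k) 0) =
      (lefschetz k ^ Nat.card τ - 1) * lefschetz k ^ (n + 1) * nondegClass k (Fin n) := by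
  suffices H : ∀ (h : Finite τ) (f : τ → ι), f.Injective →
      borderedClass k 0 (Function.extend f (X : τ → MvPolynomial τ k) 0) =
        (lefschetz k ^ Nat.card τ - 1) * lefschetz k ^ (n + 1) * nondegClass k (Fin n) from
    H ‹_› f hf
  clear hf f
  refine Finite.induction_empty_option (P := fun τ : Type => ∀ (h : Finite τ) (f : τ → ι),
    f.Injective → borderedClass k 0 (Function.extend f (X : τ → MvPolynomial τ k) 0) =
      (lefschetz k ^ Nat.card τ - 1) * lefschetz k ^ (n + 1) * nondegClass k (Fin n)) ?_ ?_ ?_ τ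
  · intro α β e ih _ f hf
    have := Finite.of_equiv β e.symm
    have h := borderedClass_congr (renameEquiv k e) 0
      (Function.extend (f ∘ e) (X : α → MvPolynomial α k) 0)
    rw [renameEquiv_comp_extend e hf, map_zero] at h
    rw [← Nat.card_congr e, ← ih this (f ∘ e) (hf.comp e.injective), h]
  · intro _ f _
    have : Function.extend f (X : PEmpty → MvPolynomial PEmpty k) 0 = 0 :=
      funext fun i => Function.extend_apply' _ _ _ (by rintro ⟨x, -⟩; exact x.elim)
    rw [this, borderedClass_zero_zero, Nat.card_eq_zero.2 (.inl inferInstance), pow_zero, sub_self,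
      zero_mul, zero_mul]
  · intro α _ ih _ f hf
    rw [borderedClass_zero_extend_option hn α hf, Finite.card_option,
      ih inferInstance (f ∘ some) (hf.comp (Option.some_injective α)), pow_succ]
    ring

/-- The corner entry is either invertible, hence a 1 × 1 pivot with the remaining row free, or zero.
-/
theorem nondegClass_succ (n : ℕ) :
    nondegClass k (Fin (n + 1)) = lefschetz k ^ n * (lefschetz k - 1) * nondegClass k (Fin n) +
      borderedClass k 0 (X : Fin n → MvPolynomial (Fin n) k) := by
  obtain ⟨e⟩ : Nonempty (Fin (n + 1) ≃ Unit ⊕ Fin n) := by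
    rw [← Fintype.card_eq]; simp [add_comm]
  rw [nondegClass_congr e, nondegClass_sum_unit, borderedClass_congr (optionEquivLeft k (Fin n)),
    borderedClass_polynomial, borderedClass_of_isUnit, ← basicOpenClass,
    basicOpenClass_polynomial_X, affineClass_mvPolynomial, affineClass_field, Nat.card_fin]
  · congr 2
    · ring
    · simp
    · ext1 i; simp
  · rw [optionEquivLeft_X_none]
    exact IsLocalization.Away.algebraMap_isUnit _

theorem nondegClass_zero : nondegClass k (Fin 0) = 1 := by
  rw [nondegClass, det_isEmpty, basicOpenClass_of_isUnit isUnit_one, affineClass_mvPolynomial,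
    affineClass_field]
  simp

theorem nondegClass_one : nondegClass k (Fin 1) = lefschetz k - 1 := by
  rw [nondegClass_succ, nondegClass_zero, Subsingleton.elim (X : Fin 0 → MvPolynomial (Fin 0) k) 0,
    borderedClass_zero_zero]
  ring

theorem nondegClass_add_two (n : ℕ) :
    nondegClass k (Fin (n + 2)) =
      lefschetz k ^ (n + 1) * (lefschetz k - 1) * nondegClass k (Fin (n + 1)) +
      (lefschetz k ^ (n + 1) - 1) * lefschetz k ^ (n + 1) * nondegClass k (Fin n) := by
  have h := borderedClass_zero_extend (k := k) (Fintype.card_fin (n + 1)) (Fin (n + 1))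
    Function.injective_id
  rw [Nat.card_fin] at h
  rw [nondegClass_succ (n + 1), ← h]
  congr 2
  ext1 i
  exact (Function.injective_id.extend_apply (X : _ → MvPolynomial (Fin (n + 1)) k) 0 i).symm

end Recursion

/-! ### Solving the recursion -/

section ClosedForm

theorem prod_Icc_zero_eq {R : Type*} [CommRing R] (q : R) (r : ℕ) :
    ∏ i ∈ Finset.Icc 0 r, (q ^ (2 * r + 1) - q ^ (2 * i)) =
      (q ^ (2 * r + 1) - 1) * ∏ i ∈ Finset.Icc 1 r, (q ^ (2 * r + 1) - q ^ (2 * i)) := by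
  rw [Finset.Icc_eq_cons_Ioc (Nat.zero_le r), Finset.prod_cons, mul_zero, pow_zero]
  rfl

/-- After the shift `i ↦ i + 1`, each of the `r + 1` factors releases a `q²`. -/
theorem prod_Icc_one_succ_eq {R : Type*} [CommRing R] (q : R) (r : ℕ) :
    ∏ i ∈ Finset.Icc 1 (r + 1), (q ^ (2 * (r + 1) + 1) - q ^ (2 * i)) =
      q ^ (2 * r + 2) * ∏ i ∈ Finset.Icc 0 r, (q ^ (2 * r + 1) - q ^ (2 * i)) := by
  have h1 : Finset.Icc 1 (r + 1) = (Finset.Icc 0 r).map (addRightEmbedding 1) := by simp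
  have h2 : (q : R) ^ (2 * r + 2) = ∏ _i ∈ Finset.Icc 0 r, q ^ 2 := by
    rw [Finset.prod_const, Nat.card_Icc, ← pow_mul]
    congr 1
  rw [h1, Finset.prod_map, h2, ← Finset.prod_mul_distrib]
  refine Finset.prod_congr rfl fun i _ => ?_
  rw [addRightEmbedding_apply]
  ring

/-- The solution of the recursion for the number of invertible symmetric matrices. -/
theorem eq_prod_of_recursion {R : Type*} [CommRing R] {q : R} {N : ℕ → R} (h0 : N 0 = 1)
    (h1 : N 1 = q - 1)
    (h : ∀ n, N (n + 2) = q ^ (n + 1) * (q - 1) * N (n + 1) +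
      (q ^ (n + 1) - 1) * q ^ (n + 1) * N n) (r : ℕ) :
    N (2 * r) = ∏ i ∈ Finset.Icc 1 r, (q ^ (2 * r + 1) - q ^ (2 * i)) ∧
      N (2 * r + 1) = ∏ i ∈ Finset.Icc 0 r, (q ^ (2 * r + 1) - q ^ (2 * i)) := by
  induction r with
  | zero => simp [h0, h1]
  | succ r ih =>
    obtain ⟨ih0, ih1⟩ := ih
    -- As `(q^(2r+1) - 1) N(2r) = N(2r+1)`, both terms of the recursion are multiples of `N(2r+1)`,
    -- with coefficients adding up to `q^(2r+2)`.
    have h2 : N (2 * (r + 1)) = q ^ (2 * r + 2) * N (2 * r + 1) := by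
      rw [mul_add, mul_one, h, ih1, prod_Icc_zero_eq, ← ih0]
      ring
    have h3 : N (2 * (r + 1)) =
        ∏ i ∈ Finset.Icc 1 (r + 1), (q ^ (2 * (r + 1) + 1) - q ^ (2 * i)) := by
      rw [h2, prod_Icc_one_succ_eq, ih1]
    refine ⟨h3, ?_⟩
    -- Likewise `q^(2r+2) N(2r+1) = N(2r+2)` collapses the recursion to `N(2r+3) = (q^(2r+3) - 1)
    -- N(2r+2)`.
    rw [prod_Icc_zero_eq, ← h3, h2, show 2 * (r + 1) + 1 = (2 * r + 1) + 2 by ring, h,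
      show 2 * r + 1 + 1 = 2 * (r + 1) by ring, h2]
    ring

end ClosedForm

/-! ### From symmetric matrices to quadratic forms -/

section QuadraticForms

open MvPolynomial Matrix

variable (k : Type u) [Field k]

/-- Two open immersions with the same range have isomorphic sources, so the pointwise rank condition
can be replaced by the principal open set of a determinant. -/
theorem classOf_quadNondeg_eq_basicOpenClass (n : ℕ) :
    classOf (quadNondeg k n) =
      basicOpenClass k (polarMatrix (R := QuadRing k n) MvPolynomial.X).det := by
  let d := (polarMatrix (R := QuadRing k n) MvPolynomial.X).det
  let i : Spec (.of (Localization.Away d)) ⟶ Spec (.of (QuadRing k n)) :=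
    Spec.map (CommRingCat.ofHom (algebraMap (QuadRing k n) (Localization.Away d)))
  have hi : IsOpenImmersion i := IsOpenImmersion.of_isLocalization (R := CommRingCat.of _) d
  have hr : Set.range (nondegenerateLocus k n).ι = Set.range i := by
    rw [Scheme.Opens.range_ι]
    refine Eq.trans ?_
      (PrimeSpectrum.localization_away_comap_range (Localization.Away d) d).symm
    exact Set.ext fun p => rank_formAt_eq_iff k n p
  let e := IsOpenImmersion.isoOfRangeEq (nondegenerateLocus k n).ι i hr
  have he : e.hom ≫ i = (nondegenerateLocus k n).ι :=
    IsOpenImmersion.isoOfRangeEq_hom_fac (nondegenerateLocus k n).ι i hr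
  refine classOf_congr (ObjectProperty.isoMk _ (Over.isoMk e ?_))
  have hs : Spec.map (CommRingCat.ofHom (algebraMap k (Localization.Away d))) =
      i ≫ Spec.map (CommRingCat.ofHom (algebraMap k (QuadRing k n))) := by
    rw [← Spec.map_comp, ← CommRingCat.ofHom_comp, ← IsScalarTower.algebraMap_eq]
  change e.hom ≫ Spec.map (CommRingCat.ofHom (algebraMap k (Localization.Away d))) =
    (nondegenerateLocus k n).ι ≫ Spec.map (CommRingCat.ofHom (algebraMap k (QuadRing k n)))
  rw [hs, reassoc_of% he]

/-- Rescaling of the variables of a polynomial ring. -/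
noncomputable def rescaleEquiv {σ R : Type*} [CommRing R] (s : σ → Rˣ) :
    MvPolynomial σ R ≃ₐ[R] MvPolynomial σ R :=
  AlgEquiv.ofAlgHom (aeval fun i => C (s i : R) * X i) (aeval fun i => C (↑(s i)⁻¹ : R) * X i)
    (by ext i : 1; simp [← mul_assoc, ← C_mul]) (by ext i : 1; simp [← mul_assoc, ← C_mul])

/-- The polar matrix is the generic symmetric matrix with its diagonal doubled, which is a change of
coordinates when 2 is a unit. This is where the characteristic enters. -/
theorem classOf_quadNondeg {k : Type u} [Field k] (h2 : (2 : k) ≠ 0) (n : ℕ) :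
    classOf (quadNondeg k n) = nondegClass k (Fin n) := by
  classical
  rw [classOf_quadNondeg_eq_basicOpenClass]
  let s : Sym2 (Fin n) → kˣ := fun z => if z.IsDiag then Units.mk0 2 h2 else 1
  refine (basicOpenClass_congr (rescaleEquiv s) (.of_eq ?_)).symm
  rw [AlgEquiv.map_det]
  congr 1
  ext1 i j
  by_cases h : i = j
  · subst h
    simp [symMatrix, polarMatrix, rescaleEquiv, s, map_ofNat C 2]
  · simp [symMatrix, polarMatrix, rescaleEquiv, s, h]

theorem classOf_quadNondeg_eq_prod {k : Type u} [Field k] (h2 : (2 : k) ≠ 0) (r : ℕ) :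
    classOf (quadNondeg k (2 * r)) =
      ∏ i ∈ Finset.Icc 1 r, (lefschetz k ^ (2 * r + 1) - lefschetz k ^ (2 * i)) ∧
    classOf (quadNondeg k (2 * r + 1)) =
      ∏ i ∈ Finset.Icc 0 r, (lefschetz k ^ (2 * r + 1) - lefschetz k ^ (2 * i)) := by
  rw [classOf_quadNondeg h2, classOf_quadNondeg h2]
  exact eq_prod_of_recursion (N := fun n => nondegClass k (Fin n)) nondegClass_zero nondegClass_one
    nondegClass_add_two r

end QuadraticForms

/-! ### Units in the completion and the generating function -/

section Completion

variable (k : Type u) [Field k]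

/-- The ring homomorphism from the Grothendieck ring to its completion. -/
noncomputable def toCompletion : K0Var k →+* K0Hat k :=
  UniformSpace.Completion.coeRingHom.comp (algebraMap (K0Var k) (K0Loc k))

theorem lefschetzInv_pow_mem (n : ℕ) : lefschetzInv k ^ n ∈ dimFiltration k n := by
  refine AddSubgroup.subset_closure ⟨specVariety k k, n, ?_, ?_⟩
  · have : topologicalKrullDim (specVariety k k).obj.left = ringKrullDim k :=
      topologicalKrullDim_spec k
    rw [this, ringKrullDim_eq_zero_of_field, zero_add]
  · rw [← affineClass, affineClass_field, map_one, mul_one]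

/-- Since `y^j` lies in `F^j`, the powers tend to zero; in a complete nonarchimedean ring this makes
the geometric series summable, and its sum is the inverse. -/
theorem isUnit_one_sub_of_mem_dimFiltration {y : K0Loc k} (hy : y ∈ dimFiltration k 1) :
    IsUnit (1 - (y : K0Hat k)) := by
  have : NonarchimedeanRing (K0Loc k) := (dimFiltration_basis k).nonarchimedean
  have hpow (j : ℕ) : y ^ (j + 1) ∈ dimFiltration k (j + 1) := by
    induction j with
    | zero => simpa using hy
    | succ j ih => rw [pow_succ]; exact mul_mem_dimFiltration k ih hy
  have ht : Filter.Tendsto (fun j : ℕ => y ^ j) Filter.atTop (nhds 0) := by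
    refine ((dimFiltration_basis k).hasBasis_nhds_zero.tendsto_right_iff).2 fun i _ => ?_
    filter_upwards [Filter.eventually_ge_atTop (i + 1)] with j hj
    obtain ⟨m, rfl⟩ := Nat.exists_eq_add_of_le hj
    rw [Nat.add_right_comm]
    exact dimFiltration_antitone k (by omega) (hpow (i + m))
  have ht' : Filter.Tendsto (fun j : ℕ => (y : K0Hat k) ^ j) Filter.cofinite (nhds 0) := by
    rw [Nat.cofinite_eq_atTop]
    have := ((UniformSpace.Completion.continuous_coe (K0Loc k)).tendsto 0).comp ht
    refine this.congr fun j => ?_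
    exact map_pow (UniformSpace.Completion.coeRingHom (α := K0Loc k)) y j
  have hs := NonarchimedeanAddGroup.summable_of_tendsto_cofinite_zero ht'
  exact IsUnit.of_mul_eq_one _ hs.one_sub_mul_tsum_pow

theorem isUnit_L : IsUnit (L k) := by
  have h : IsUnit (algebraMap (K0Var k) (K0Loc k) (lefschetz k)) :=
    IsLocalization.Away.algebraMap_isUnit _
  exact h.map (UniformSpace.Completion.coeRingHom (α := K0Loc k))

theorem isUnit_L_pow_sub_one {n : ℕ} (hn : n ≠ 0) : IsUnit (L k ^ n - 1) := by
  have h1 : L k ^ n * ((lefschetzInv k ^ n : K0Loc k) : K0Hat k) = 1 := by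
    have : algebraMap (K0Var k) (K0Loc k) (lefschetz k) ^ n * lefschetzInv k ^ n = 1 := by
      rw [← mul_pow, lefschetzInv, IsLocalization.Away.mul_invSelf, one_pow]
    have h := congrArg (UniformSpace.Completion.coeRingHom (α := K0Loc k)) this
    rw [map_mul, map_pow, map_one] at h
    exact h
  have h2 : L k ^ n - 1 = L k ^ n * (1 - ((lefschetzInv k ^ n : K0Loc k) : K0Hat k)) := by
    rw [mul_sub, h1, mul_one]
  rw [h2]
  exact ((isUnit_L k).pow n).mul (isUnit_one_sub_of_mem_dimFiltration k
    (dimFiltration_antitone k (Nat.one_le_iff_ne_zero.2 hn) (lefschetzInv_pow_mem k n)))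

/-- A divisor of the unit `𝕃^n - 1 = [n]_𝕃 (𝕃 - 1)` is a unit. -/
theorem isUnit_gaussInt {n : ℕ} (hn : n ≠ 0) : IsUnit (gaussInt (L k) n) :=
  isUnit_of_mul_isUnit_left (y := L k - 1) (by
    rw [gaussInt, geom_sum_mul]
    exact isUnit_L_pow_sub_one k hn)

theorem isUnit_gaussFactorial (n : ℕ) : IsUnit (gaussFactorial (L k) n) :=
  IsUnit.prod_iff.2 fun i hi => isUnit_gaussInt k (by
    have := (Finset.mem_Icc.1 hi).1
    omega)

theorem motive_quadNondeg {k : Type u} [Field k] (h2 : (2 : k) ≠ 0) (r : ℕ) :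
    motive (quadNondeg k (2 * r)) =
      ∏ i ∈ Finset.Icc 1 r, (L k ^ (2 * r + 1) - L k ^ (2 * i)) ∧
    motive (quadNondeg k (2 * r + 1)) =
      ∏ i ∈ Finset.Icc 0 r, (L k ^ (2 * r + 1) - L k ^ (2 * i)) := by
  obtain ⟨h, h'⟩ := classOf_quadNondeg_eq_prod h2 r
  have hm (X : Variety k) : motive X = toCompletion k (classOf X) := rfl
  have hL : L k = toCompletion k (lefschetz k) := rfl
  rw [hm, hm, h, h', hL, map_prod, map_prod]
  simp only [map_sub, map_pow, and_self]

theorem G_eq_PEven_add_POdd {k : Type u} [Field k] (h2 : (2 : k) ≠ 0) :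
    G k = PEven k + POdd k := by
  ext n
  rw [map_add, G, PEven, POdd, PowerSeries.coeff_mk, PowerSeries.coeff_mk, PowerSeries.coeff_mk]
  rcases Nat.even_or_odd' n with ⟨r, rfl | rfl⟩
  · have h : ¬ Odd (2 * r) := by simp
    rw [if_pos (even_two_mul r), if_neg h, add_zero, (motive_quadNondeg h2 r).1, mul_comm,
      Nat.mul_div_cancel_left r two_pos]
  · have h : ¬ Even (2 * r + 1) := by simp
    have hr : (2 * r + 1) / 2 = r := by omega
    rw [if_pos (odd_two_mul_add_one r), if_neg h, zero_add, (motive_quadNondeg h2 r).2, mul_comm,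
      hr]

end Completion
end Motivic

theorem corollary3p6 (k : Type u) [Field k] (hk : ringChar k ≠ 2) :
    (∀ n : ℕ, IsUnit (Motivic.gaussFactorial (Motivic.L k) n)) ∧
    Motivic.G k = Motivic.PEven k + Motivic.POdd k ∧
    (∀ r : ℕ, Motivic.motive (Motivic.quadNondeg k (2 * r + 1)) =
      ∏ i ∈ Finset.Icc 0 r, (Motivic.L k ^ (2 * r + 1) - Motivic.L k ^ (2 * i))) ∧
    (∀ r : ℕ, Motivic.motive (Motivic.quadNondeg k (2 * r)) =
      ∏ i ∈ Finset.Icc 1 r, (Motivic.L k ^ (2 * r + 1) - Motivic.L k ^ (2 * i))) := by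
  have h2 : (2 : k) ≠ 0 := Ring.two_ne_zero hk
  exact ⟨Motivic.isUnit_gaussFactorial k, Motivic.G_eq_PEven_add_POdd h2,
    fun r => (Motivic.motive_quadNondeg h2 r).2, fun r => (Motivic.motive_quadNondeg h2 r).1⟩
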